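/- Let $n\ge 0$ and let $\chi(\mathbb R^n)$ be the real vector space of smooth vector fields $X=\sum_{i=1}^n X^i\partial_i$ on $\mathbb R^n$. It is a left pre-Lie algebra for the product given by the canonical flat torsion-free connection, $$\Big(\sum_i f_i\partial_i\Big)\rhd\Big(\sum_j g_j\partial_j\Big)=\sum_{i,j} f_i(\partial_i g_j)\,\partial_j .$$ Let $\mathcal T$ be the free left pre-Lie algebra on the vector space $\chi(\mathbb R^n)$. It is spanned by the isomorphism classes of finite (non-planar, nonempty) rooted trees whose vertices are decorated by vector fields, subject to linearity in the decoration of each vertex. Its product $s\to t$, for trees $s,t$, is the sum of the trees obtained by grafting the root of $s$ on each of the vertices of $t$. Write $\bullet_X$ for the one-vertex tree decorated by $X$. Edges of a rooted tree are oriented towards the root, and $w\to v$ means that there is an edge from $w$ to $v$ (that is, $w$ is a child of $v$). There is a unique morphism of pre-Lie algebras $\mathcal Y:\mathcal T\to\chi(\mathbb R^n)$, the Cayley map, such that $\mathcal Y(\bullet_X)=X$ for every vector field $X$. For every rooted tree $t$ with set of vertices $\mathcal V(t)$ and root $r$, each vertex $v$ being decorated by a vector field $X_v=\sum_{i=1}^n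 X_v^i\partial_i$, the vector field $\mathcal Y(t)$ is given at every $x\in\mathbb R^n$ by $$\mathcal Y(t)(x)=\sum_{F:\mathcal V(t)\to\{1,\ldots,n\}}\Big(\prod_{v\in\mathcal V(t)\setminus\{r\}}\big(\partial_{I(v)}X_v^{F(v)}\big)(x)\Big)\,\big(\partial_{I(r)}X_r^{F(r)}\big)(x)\,\partial_{F(r)},$$ where $\partial_{I(v)}:=\prod_{w\to v}\partial_{F(w)}$ is the product of the commuting operators $\partial_{F(w)}$ over all children $w$ of $v$ (the identity if $v$ has no child). -/

import Mathlib

open scoped ContDiff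

set_option linter.unusedSectionVars false

noncomputable section

namespace CayleyMap

/-! ### Rooted trees and decorated rooted trees -/

/-- A rooted tree: a finite nonempty oriented graph with a distinguished root, in which every
vertex other than the root has exactly one outgoing edge (with target `target v`), the root has
none, and every vertex is joined to the root by following the outgoing edges. -/
structure RootedTree where
  Vertex : Type
  [fintypeVertex : Fintype Vertex]
  [decEqVertex : DecidableEq Vertex]
  root : Vertex
  target : Vertex → Option Vertex
  target_eq_none_iff : ∀ v, target v = none ↔ v = root
  reaches_root : ∀ v, Relation.ReflTransGen (fun w u => target w = some u) v root

attribute [instance] RootedTree.fintypeVertex RootedTree.decEqVertex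

/-- The incoming vertices (children) of `v`: the `w` with an edge `w → v`. -/
def RootedTree.incoming (t : RootedTree) (v : t.Vertex) : Finset t.Vertex :=
  Finset.univ.filter fun w => t.target w = some v

/-- The rooted tree with a single vertex. -/
def RootedTree.single : RootedTree where
  Vertex := Unit
  root := ()
  target _ := none
  target_eq_none_iff _ := by simp
  reaches_root _ := Relation.ReflTransGen.refl

/-- Targets of the edges after grafting: given the targets `f` on `A` and `g` on `B`, on the
disjoint union `A ⊕ B` a new edge from the root of `A` to `v` is added. -/
def graftTarget {A B : Type} (f : A → Option A) (g : B → Option B) (v : B) :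
    A ⊕ B → Option (A ⊕ B)
  | Sum.inl a => some (match f a with
      | none => Sum.inr v
      | some b => Sum.inl b)
  | Sum.inr b => (g b).map Sum.inr

theorem graftTarget_map {A B A' B' : Type} (f : A → Option A) (g : B → Option B)
    (f' : A' → Option A') (g' : B' → Option B') (e : A ≃ A') (e' : B ≃ B')
    (he : ∀ a, f' (e a) = (f a).map e) (he' : ∀ b, g' (e' b) = (g b).map e') (v : B)
    (x : A ⊕ B) :
    graftTarget f' g' (e' v) (Equiv.sumCongr e e' x)
      = (graftTarget f g v x).map (Equiv.sumCongr e e') := by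
  rcases x with a | b
  · simp only [graftTarget, Equiv.sumCongr_apply, Sum.map_inl, he]
    cases f a <;> simp
  · simp [graftTarget, he', Function.comp_def]

theorem graftTarget_inl {A B C : Type} (f : A → Option A) (g : B → Option B) (h : C → Option C)
    (w : B) (v : C) (x : A ⊕ (B ⊕ C)) :
    graftTarget (graftTarget f g w) h v ((Equiv.sumAssoc A B C).symm x)
      = (graftTarget f (graftTarget g h v) (Sum.inl w) x).map (Equiv.sumAssoc A B C).symm := by
  rcases x with a | b | c
  · simp only [graftTarget, Equiv.sumAssoc_symm_apply_inl]
    cases f a <;> simp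
  · simp only [graftTarget, Equiv.sumAssoc_symm_apply_inr_inl]
    cases g b <;> simp
  · simp only [graftTarget, Equiv.sumAssoc_symm_apply_inr_inr]
    cases h c <;> simp

/-- The bijection `A ⊔ (B ⊔ C) ≃ B ⊔ (A ⊔ C)`. -/
def sumLeftComm (A B C : Type) : A ⊕ (B ⊕ C) ≃ B ⊕ (A ⊕ C) :=
  ((Equiv.sumAssoc A B C).symm.trans (Equiv.sumCongr (Equiv.sumComm A B) (Equiv.refl C))).trans
    (Equiv.sumAssoc B A C)

theorem graftTarget_inr {A B C : Type} (f : A → Option A) (g : B → Option B) (h : C → Option C)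
    (w v : C) (x : A ⊕ (B ⊕ C)) :
    graftTarget g (graftTarget f h w) (Sum.inr v) (sumLeftComm A B C x)
      = (graftTarget f (graftTarget g h v) (Sum.inr w) x).map (sumLeftComm A B C) := by
  rcases x with a | b | c
  · simp only [sumLeftComm, graftTarget, Equiv.trans_apply, Equiv.sumAssoc_symm_apply_inl,
      Equiv.sumCongr_apply, Sum.map_inl, Equiv.sumComm_apply, Sum.swap_inl,
      Equiv.sumAssoc_apply_inl_inr]
    cases f a <;> simp
  · simp only [sumLeftComm, graftTarget, Equiv.trans_apply, Equiv.sumAssoc_symm_apply_inr_inl,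
      Equiv.sumCongr_apply, Sum.map_inl, Equiv.sumComm_apply, Sum.swap_inr,
      Equiv.sumAssoc_apply_inl_inl]
    cases g b <;> simp
  · simp only [sumLeftComm, graftTarget, Equiv.trans_apply, Equiv.sumAssoc_symm_apply_inr_inr,
      Equiv.sumCongr_apply, Sum.map_inr, Equiv.refl_apply, Equiv.sumAssoc_apply_inr]
    cases h c <;> simp

theorem RootedTree.graft_reaches_inr (s t : RootedTree) (v b : t.Vertex) :
    Relation.ReflTransGen (fun w u => graftTarget s.target t.target v w = some u) (Sum.inr b)
      (Sum.inr t.root) := by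
  refine Relation.ReflTransGen.lift (r := fun w u => t.target w = some u)
    (Sum.inr : t.Vertex → s.Vertex ⊕ t.Vertex) (fun a c h => ?_) _ _ (t.reaches_root b)
  simp [Function.onFun, graftTarget, h]

theorem RootedTree.graft_reaches_inl (s t : RootedTree) (v : t.Vertex) (a : s.Vertex) :
    Relation.ReflTransGen (fun w u => graftTarget s.target t.target v w = some u) (Sum.inl a)
      (Sum.inr t.root) := by
  have h1 : Relation.ReflTransGen (fun w u => graftTarget s.target t.target v w = some u)
      (Sum.inl a) (Sum.inl s.root) := by
    refine Relation.ReflTransGen.lift (r := fun w u => s.target w = some u)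
      (Sum.inl : s.Vertex → s.Vertex ⊕ t.Vertex) (fun a c h => ?_) _ _ (s.reaches_root a)
    simp [Function.onFun, graftTarget, h]
  have h2 : graftTarget s.target t.target v (Sum.inl s.root) = some (Sum.inr v) := by
    have h3 := (s.target_eq_none_iff s.root).2 rfl
    simp [graftTarget, h3]
  exact (h1.tail h2).trans (s.graft_reaches_inr t v v)

/-- The tree obtained by grafting `s` on `t` at the vertex `v` of `t`. -/
def RootedTree.graft (s t : RootedTree) (v : t.Vertex) : RootedTree where
  Vertex := s.Vertex ⊕ t.Vertex
  root := Sum.inr t.root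
  target := graftTarget s.target t.target v
  target_eq_none_iff
    | Sum.inl a => by simp [graftTarget]
    | Sum.inr b => by simp [graftTarget, t.target_eq_none_iff]
  reaches_root
    | Sum.inl a => s.graft_reaches_inl t v a
    | Sum.inr b => s.graft_reaches_inr t v b

/-- A rooted tree each vertex of which is decorated by an element of `D`. -/
structure DecTree (D : Type*) extends RootedTree where
  dec : Vertex → D

namespace DecTree

variable {D : Type*}

/-- The tree `•_x` with one vertex, decorated by `x`. -/
def single (x : D) : DecTree D := { RootedTree.single with dec := fun _ => x }

/-- Grafting of decorated trees; every vertex keeps its decoration. -/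
def graft (s t : DecTree D) (v : t.Vertex) : DecTree D :=
  { s.toRootedTree.graft t.toRootedTree v with dec := Sum.elim s.dec t.dec }

/-- The same tree with the decoration of the vertex `v` replaced by `x`. -/
def redecorate (t : DecTree D) (v : t.Vertex) (x : D) : DecTree D :=
  { t with dec := Function.update t.dec v x }

/-- Two decorated trees are isomorphic if a bijection between their vertices preserves the edges
and the decorations (hence also the roots). -/
def Iso (s t : DecTree D) : Prop :=
  ∃ e : s.Vertex ≃ t.Vertex,
    (∀ v, t.target (e v) = (s.target v).map e) ∧ ∀ v, t.dec (e v) = s.dec v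

end DecTree

/-! ### The free pre-Lie algebra on a module

It is spanned by isomorphism classes of rooted trees decorated by elements of `M`, the
decorations being multilinear. If `M` is free with basis `B`, then the isomorphism classes of trees
decorated by `B` form a basis. The pre-Lie product `s → t` is the sum of the graftings of `s` on `t` at all vertices
of `t`. -/

section Free

variable (R : Type*) [CommRing R] (M : Type*) [AddCommGroup M] [Module R M]

/-- The relations: isomorphic trees are identified, and a tree is linear in each decoration. -/
inductive Relator : (DecTree M →₀ R) → Prop
  | iso (s t : DecTree M) (h : s.Iso t) :
      Relator (Finsupp.single s 1 - Finsupp.single t 1)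
  | add (t : DecTree M) (v : t.Vertex) (x y : M) :
      Relator (Finsupp.single (t.redecorate v (x + y)) 1 -
        (Finsupp.single (t.redecorate v x) 1 + Finsupp.single (t.redecorate v y) 1))
  | smul (t : DecTree M) (v : t.Vertex) (c : R) (x : M) :
      Relator (Finsupp.single (t.redecorate v (c • x)) 1 -
        c • Finsupp.single (t.redecorate v x) 1)

def relations : Submodule R (DecTree M →₀ R) := Submodule.span R {z | Relator R M z}

/-- The underlying module of the free pre-Lie algebra on the module `M`. -/
def FreePreLie : Type _ := (DecTree M →₀ R) ⧸ relations R M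

instance : AddCommGroup (FreePreLie R M) :=
  inferInstanceAs (AddCommGroup ((DecTree M →₀ R) ⧸ relations R M))

instance : Module R (FreePreLie R M) :=
  inferInstanceAs (Module R ((DecTree M →₀ R) ⧸ relations R M))

namespace FreePreLie

def mk : (DecTree M →₀ R) →ₗ[R] FreePreLie R M := (relations R M).mkQ

variable {M}

/-- The element of the free pre-Lie algebra given by a decorated rooted tree. -/
def ofTree (t : DecTree M) : FreePreLie R M := mk R M (Finsupp.single t 1)

/-- The generator `•_x`. -/
def gen (x : M) : FreePreLie R M := ofTree R (DecTree.single x)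

variable {R}

theorem mk_eq_zero {z : DecTree M →₀ R} (h : Relator R M z) : mk R M z = 0 :=
  (Submodule.Quotient.mk_eq_zero _).2 (Submodule.subset_span h)

theorem ofTree_iso {s t : DecTree M} (h : s.Iso t) : ofTree R s = ofTree R t := by
  have := mk_eq_zero (Relator.iso (R := R) s t h)
  rwa [map_sub, sub_eq_zero] at this

theorem ofTree_add (t : DecTree M) (v : t.Vertex) (x y : M) :
    ofTree R (t.redecorate v (x + y)) =
      ofTree R (t.redecorate v x) + ofTree R (t.redecorate v y) := by
  have := mk_eq_zero (Relator.add (R := R) t v x y)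
  rwa [map_sub, map_add, sub_eq_zero] at this

theorem ofTree_smul (t : DecTree M) (v : t.Vertex) (c : R) (x : M) :
    ofTree R (t.redecorate v (c • x)) = c • ofTree R (t.redecorate v x) := by
  have := mk_eq_zero (Relator.smul t v c x)
  rwa [map_sub, map_smul, sub_eq_zero] at this

variable (R) in
/-- The sum of the graftings of `s` on `t` at all vertices of `t`. -/
def graftSum (s t : DecTree M) : FreePreLie R M :=
  ∑ v : t.Vertex, ofTree R (s.graft t v)

theorem graftSum_iso_right (s : DecTree M) {t t' : DecTree M} (h : t.Iso t') :
    graftSum R s t = graftSum R s t' := by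
  obtain ⟨e, he, hd⟩ := h
  refine Fintype.sum_equiv e _ _ fun v => ofTree_iso ⟨Equiv.sumCongr (Equiv.refl _) e, ?_, ?_⟩
  · exact graftTarget_map s.target t.target s.target t'.target (Equiv.refl _) e
      (fun a => by simp) he v
  · rintro (a | b)
    · rfl
    · exact hd b

theorem graftSum_iso_left {s s' : DecTree M} (h : s.Iso s') (t : DecTree M) :
    graftSum R s t = graftSum R s' t := by
  obtain ⟨e, he, hd⟩ := h
  refine Finset.sum_congr rfl fun v _ => ofTree_iso ⟨Equiv.sumCongr e (Equiv.refl _), ?_, ?_⟩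
  · exact graftTarget_map s.target t.target s'.target t.target e (Equiv.refl _)
      he (fun a => by simp) v
  · rintro (a | b)
    · exact hd a
    · rfl

theorem graft_redecorate_left (s : DecTree M) (a : s.Vertex) (x : M) (t : DecTree M)
    (v : t.Vertex) :
    (s.redecorate a x).graft t v = (s.graft t v).redecorate (Sum.inl a) x :=
  congrArg (DecTree.mk (s.toRootedTree.graft t.toRootedTree v))
    (Sum.update_elim_inl (f := s.dec) (g := t.dec) (i := a) (x := x)).symm

theorem graft_redecorate_right (s t : DecTree M) (b : t.Vertex) (x : M) (v : t.Vertex) :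
    s.graft (t.redecorate b x) v = (s.graft t v).redecorate (Sum.inr b) x :=
  congrArg (DecTree.mk (s.toRootedTree.graft t.toRootedTree v))
    (Sum.update_elim_inr (f := s.dec) (g := t.dec) (i := b) (x := x)).symm

theorem lift_single {N : Type*} [AddCommGroup N] [Module R N] (f : DecTree M → N)
    (t : DecTree M) : Finsupp.lift N R (DecTree M) f (Finsupp.single t 1) = f t := by
  simp

theorem graftSum_redecorate_left (s : DecTree M) (a : s.Vertex) (x : M) (t : DecTree M) :
    graftSum R (s.redecorate a x) t
      = ∑ v : t.Vertex, ofTree R ((s.graft t v).redecorate (Sum.inl a) x) :=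
  Finset.sum_congr rfl fun v _ => congrArg (ofTree R) (graft_redecorate_left s a x t v)

theorem graftSum_redecorate_right (s t : DecTree M) (b : t.Vertex) (x : M) :
    graftSum R s (t.redecorate b x)
      = ∑ v : t.Vertex, ofTree R ((s.graft t v).redecorate (Sum.inr b) x) :=
  Finset.sum_congr rfl fun v _ => congrArg (ofTree R) (graft_redecorate_right s t b x v)

theorem relations_le_ker_right (s : DecTree M) :
    relations R M ≤ LinearMap.ker (Finsupp.lift (FreePreLie R M) R (DecTree M) (graftSum R s)) := by
  refine Submodule.span_le.2 ?_
  rintro _ (⟨t, t', h⟩ | ⟨t, v, x, y⟩ | ⟨t, v, c, x⟩)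
  · rw [SetLike.mem_coe, LinearMap.mem_ker, map_sub, lift_single, lift_single,
      graftSum_iso_right s h, sub_self]
  · rw [SetLike.mem_coe, LinearMap.mem_ker, map_sub, map_add, lift_single, lift_single,
      lift_single, sub_eq_zero]
    simp only [graftSum_redecorate_right]
    exact (Finset.sum_congr rfl fun w _ => ofTree_add (s.graft t w) (Sum.inr v) x y).trans
      Finset.sum_add_distrib
  · rw [SetLike.mem_coe, LinearMap.mem_ker, map_sub, map_smul, lift_single, lift_single,
      sub_eq_zero]
    simp only [graftSum_redecorate_right]
    exact (Finset.sum_congr rfl fun w _ => ofTree_smul (s.graft t w) (Sum.inr v) c x).trans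
      Finset.smul_sum.symm

variable (R) in
/-- `t ↦ (s → t)` for a tree `s`, extended linearly in `t`. -/
def graftTree (s : DecTree M) : FreePreLie R M →ₗ[R] FreePreLie R M :=
  (relations R M).liftQ (Finsupp.lift (FreePreLie R M) R (DecTree M) (graftSum R s))
    (relations_le_ker_right s)

theorem graftTree_ofTree (s t : DecTree M) : graftTree R s (ofTree R t) = graftSum R s t := by
  change Finsupp.lift (FreePreLie R M) R (DecTree M) (graftSum R s) (Finsupp.single t 1) = _
  simp

theorem hom_ext {N : Type*} [AddCommGroup N] [Module R N] {f g : FreePreLie R M →ₗ[R] N}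
    (h : ∀ t, f (ofTree R t) = g (ofTree R t)) : f = g := by
  refine Submodule.linearMap_qext _ (Finsupp.lhom_ext' fun t => LinearMap.ext_ring ?_)
  exact h t

theorem relations_le_ker_left :
    relations R M ≤ LinearMap.ker
      (Finsupp.lift (FreePreLie R M →ₗ[R] FreePreLie R M) R (DecTree M) (graftTree R)) := by
  refine Submodule.span_le.2 ?_
  rintro _ (⟨s, s', h⟩ | ⟨s, v, x, y⟩ | ⟨s, v, c, x⟩)
  · rw [SetLike.mem_coe, LinearMap.mem_ker, map_sub, lift_single, lift_single, sub_eq_zero]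
    refine hom_ext fun t => ?_
    simp only [graftTree_ofTree, graftSum_iso_left h]
  · rw [SetLike.mem_coe, LinearMap.mem_ker, map_sub, map_add, lift_single, lift_single,
      lift_single, sub_eq_zero]
    refine hom_ext fun t => ?_
    simp only [LinearMap.add_apply, graftTree_ofTree, graftSum_redecorate_left]
    exact (Finset.sum_congr rfl fun w _ => ofTree_add (s.graft t w) (Sum.inl v) x y).trans
      Finset.sum_add_distrib
  · rw [SetLike.mem_coe, LinearMap.mem_ker, map_sub, map_smul, lift_single, lift_single,
      sub_eq_zero]
    refine hom_ext fun t => ?_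
    simp only [LinearMap.smul_apply, graftTree_ofTree, graftSum_redecorate_left]
    exact (Finset.sum_congr rfl fun w _ => ofTree_smul (s.graft t w) (Sum.inl v) c x).trans
      Finset.smul_sum.symm

variable (R M) in
/-- The bilinear grafting product `(a, b) ↦ (a → b)`. -/
def graft : FreePreLie R M →ₗ[R] FreePreLie R M →ₗ[R] FreePreLie R M :=
  (relations R M).liftQ
    (Finsupp.lift (FreePreLie R M →ₗ[R] FreePreLie R M) R (DecTree M) (graftTree R))
    relations_le_ker_left

theorem graft_ofTree (s t : DecTree M) :
    graft R M (ofTree R s) (ofTree R t) = ∑ v : t.Vertex, ofTree R (s.graft t v) := by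
  rw [← graftSum, ← graftTree_ofTree]
  congr 1
  change Finsupp.lift (FreePreLie R M →ₗ[R] FreePreLie R M) R (DecTree M) (graftTree R)
    (Finsupp.single s 1) = _
  simp

/-- The product of the free pre-Lie algebra is grafting. -/
instance : Mul (FreePreLie R M) := ⟨fun a b => graft R M a b⟩

theorem mul_def (a b : FreePreLie R M) : a * b = graft R M a b := rfl

instance : NonUnitalNonAssocRing (FreePreLie R M) :=
  { (inferInstance : AddCommGroup (FreePreLie R M)),
    (inferInstance : Mul (FreePreLie R M)) with
    left_distrib := fun a b c => by simp [mul_def]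
    right_distrib := fun a b c => by simp [mul_def]
    zero_mul := fun a => by simp [mul_def]
    mul_zero := fun a => by simp [mul_def] }

theorem ofTree_mul_ofTree (s t : DecTree M) :
    ofTree R s * ofTree R t = ∑ v : t.Vertex, ofTree R (s.graft t v) := graft_ofTree s t

theorem graft_graft_inl_iso (s t u : DecTree M) (w : t.Vertex) (v : u.Vertex) :
    (s.graft (t.graft u v) (Sum.inl w)).Iso ((s.graft t w).graft u v) := by
  refine ⟨(Equiv.sumAssoc s.Vertex t.Vertex u.Vertex).symm, ?_, ?_⟩
  · exact graftTarget_inl s.target t.target u.target w v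
  · rintro (a | b | c) <;> rfl

theorem graft_graft_inr_iso (s t u : DecTree M) (w v : u.Vertex) :
    (s.graft (t.graft u v) (Sum.inr w)).Iso (t.graft (s.graft u w) (Sum.inr v)) := by
  refine ⟨sumLeftComm s.Vertex t.Vertex u.Vertex, ?_, ?_⟩
  · exact graftTarget_inr s.target t.target u.target w v
  · rintro (a | b | c) <;> rfl

theorem associator_ofTree (s t u : DecTree M) :
    associator (ofTree R s) (ofTree R t) (ofTree R u)
      = -∑ v : u.Vertex, ∑ w : u.Vertex, ofTree R (s.graft (t.graft u v) (Sum.inr w)) := by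
  have h1 : ofTree R s * (ofTree R t * ofTree R u) = ∑ v : u.Vertex,
      (∑ w : t.Vertex, ofTree R (s.graft (t.graft u v) (Sum.inl w)) +
        ∑ w : u.Vertex, ofTree R (s.graft (t.graft u v) (Sum.inr w))) := by
    rw [ofTree_mul_ofTree, Finset.mul_sum]
    refine Finset.sum_congr rfl fun v _ => ?_
    rw [ofTree_mul_ofTree]
    exact Fintype.sum_sum_type _
  have h2 : (ofTree R s * ofTree R t) * ofTree R u = ∑ v : u.Vertex,
      ∑ w : t.Vertex, ofTree R (s.graft (t.graft u v) (Sum.inl w)) := by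
    rw [ofTree_mul_ofTree, Finset.sum_mul, Finset.sum_comm]
    refine Finset.sum_congr rfl fun w _ => ?_
    rw [ofTree_mul_ofTree]
    exact Finset.sum_congr rfl fun v _ => (ofTree_iso (graft_graft_inl_iso s t u w v)).symm
  rw [associator_apply, h1, h2, Finset.sum_add_distrib]
  abel

theorem associator_symm_ofTree (s t u : DecTree M) :
    associator (ofTree R s) (ofTree R t) (ofTree R u)
      = associator (ofTree R t) (ofTree R s) (ofTree R u) := by
  rw [associator_ofTree, associator_ofTree, Finset.sum_comm]
  congr 1
  exact Finset.sum_congr rfl fun v _ => Finset.sum_congr rfl fun w _ =>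
    ofTree_iso (graft_graft_inr_iso s t u v w)

instance : IsScalarTower R (FreePreLie R M) (FreePreLie R M) where
  smul_assoc c a b := by simp [mul_def]

instance : SMulCommClass R (FreePreLie R M) (FreePreLie R M) where
  smul_comm c a b := by simp [mul_def]

theorem induction {p : FreePreLie R M → Prop} (htree : ∀ t, p (ofTree R t))
    (hadd : ∀ a b, p a → p b → p (a + b)) (hsmul : ∀ (c : R) a, p a → p (c • a))
    (a : FreePreLie R M) : p a := by
  obtain ⟨z, rfl⟩ := Submodule.mkQ_surjective (relations R M) a
  change p (mk R M z)
  have hz : mk R M 0 = (0 : R) • ofTree R (DecTree.single 0) := by rw [map_zero, zero_smul]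
  induction z using Finsupp.induction_linear with
  | zero => rw [hz]; exact hsmul _ _ (htree _)
  | add f g hf hg => rw [map_add]; exact hadd _ _ hf hg
  | single t c =>
    have h : (Finsupp.single t c : DecTree M →₀ R) = c • Finsupp.single t 1 := by simp
    rw [h, map_smul]
    exact hsmul _ _ (htree t)

instance : LeftPreLieRing (FreePreLie R M) where
  assoc_symm' a b c := by
    induction a using induction with
    | hadd a a' ha ha' =>
      simp only [associator_apply, add_mul, mul_add] at ha ha' ⊢
      rw [add_sub_add_comm, ha, ha', ← add_sub_add_comm]
    | hsmul r a ha =>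
      simp only [associator_apply, smul_mul_assoc, mul_smul_comm, ← smul_sub] at ha ⊢
      rw [ha]
    | htree s =>
    induction b using induction with
    | hadd a a' ha ha' =>
      simp only [associator_apply, add_mul, mul_add] at ha ha' ⊢
      rw [add_sub_add_comm, ha, ha', ← add_sub_add_comm]
    | hsmul r a ha =>
      simp only [associator_apply, smul_mul_assoc, mul_smul_comm, ← smul_sub] at ha ⊢
      rw [ha]
    | htree t =>
    induction c using induction with
    | hadd a a' ha ha' =>
      simp only [associator_apply, mul_add] at ha ha' ⊢
      rw [add_sub_add_comm, ha, ha', ← add_sub_add_comm]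
    | hsmul r a ha =>
      simp only [associator_apply, mul_smul_comm, ← smul_sub] at ha ⊢
      rw [ha]
    | htree u => exact associator_symm_ofTree s t u

instance : LeftPreLieAlgebra R (FreePreLie R M) where

end FreePreLie

end Free

/-! ### Smooth functions and vector fields on `ℝⁿ` -/

/-- The algebra `C^∞(ℝⁿ)` of smooth real functions on `ℝⁿ`. -/
def smoothFunctions (n : ℕ) : Subalgebra ℝ ((Fin n → ℝ) → ℝ) where
  carrier := {f | ContDiff ℝ ∞ f}
  mul_mem' {f g} hf hg := by
    rw [Set.mem_ofPred_eq] at hf hg ⊢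
    exact hf.mul hg
  add_mem' {f g} hf hg := by
    rw [Set.mem_ofPred_eq] at hf hg ⊢
    exact hf.add hg
  algebraMap_mem' c := by
    rw [Set.mem_ofPred_eq]
    exact contDiff_const

/-- The space `χ(ℝⁿ)` of smooth vector fields, as smooth maps `ℝⁿ → ℝⁿ`. -/
def vectorFields (n : ℕ) : Submodule ℝ ((Fin n → ℝ) → (Fin n → ℝ)) where
  carrier := {X | ContDiff ℝ ∞ X}
  add_mem' {f g} hf hg := by
    rw [Set.mem_ofPred_eq] at hf hg ⊢
    exact hf.add hg
  zero_mem' := by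
    rw [Set.mem_ofPred_eq]
    exact contDiff_const
  smul_mem' c f hf := by
    rw [Set.mem_ofPred_eq] at hf ⊢
    exact hf.const_smul c

abbrev SmoothFunction (n : ℕ) : Type := smoothFunctions n

def VectorField (n : ℕ) : Type := vectorFields n

instance (n : ℕ) : AddCommGroup (VectorField n) := inferInstanceAs (AddCommGroup (vectorFields n))

instance (n : ℕ) : Module ℝ (VectorField n) := inferInstanceAs (Module ℝ (vectorFields n))

instance (n : ℕ) : CoeFun (VectorField n) fun _ => (Fin n → ℝ) → (Fin n → ℝ) := ⟨Subtype.val⟩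

variable {n : ℕ}

theorem SmoothFunction.contDiff (f : SmoothFunction n) : ContDiff ℝ ∞ (f : (Fin n → ℝ) → ℝ) :=
  f.2

theorem VectorField.contDiff (X : VectorField n) :
    ContDiff ℝ ∞ (fun x => X x) :=
  X.2

/-- The partial derivative `∂_i` on smooth functions. -/
def partialDeriv (i : Fin n) : Module.End ℝ (SmoothFunction n) where
  toFun f := ⟨fun x => fderiv ℝ (f : (Fin n → ℝ) → ℝ) x (Pi.single i 1),
    (f.contDiff.fderiv_right (m := ∞) (by simp)).clm_apply contDiff_const⟩
  map_add' f g := by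
    ext x
    have hf := (f.contDiff.differentiable (by simp)) x
    have hg := (g.contDiff.differentiable (by simp)) x
    have h := fderiv_add hf hg
    exact congrArg (fun L => L (Pi.single i 1)) h
  map_smul' c f := by
    ext x
    have hf := (f.contDiff.differentiable (by simp)) x
    have h := fderiv_const_smul hf c
    exact congrArg (fun L => L (Pi.single i 1)) h

theorem partialDeriv_apply (i : Fin n) (f : SmoothFunction n) (x : Fin n → ℝ) :
    (partialDeriv i f : (Fin n → ℝ) → ℝ) x
      = fderiv ℝ (f : (Fin n → ℝ) → ℝ) x (Pi.single i 1) := rfl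

theorem partialDeriv_mul (i : Fin n) (f g : SmoothFunction n) :
    partialDeriv i (f * g) = f * partialDeriv i g + partialDeriv i f * g := by
  ext x
  have hf := (f.contDiff.differentiable (by simp)) x
  have hg := (g.contDiff.differentiable (by simp)) x
  have h := congrArg (fun L => L (Pi.single i 1)) (fderiv_mul hf hg)
  refine h.trans ?_
  simp [partialDeriv_apply, mul_comm]

theorem partialDeriv_partialDeriv_apply (i j : Fin n) (f : SmoothFunction n) (x : Fin n → ℝ) :
    (partialDeriv i (partialDeriv j f) : (Fin n → ℝ) → ℝ) x
      = fderiv ℝ (fderiv ℝ (f : (Fin n → ℝ) → ℝ)) x (Pi.single i 1) (Pi.single j 1) := by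
  have h1 : DifferentiableAt ℝ (fderiv ℝ (f : (Fin n → ℝ) → ℝ)) x :=
    ((f.contDiff.fderiv_right (m := ∞) (by simp)).differentiable (by simp)) x
  have h2 := fderiv_clm_apply h1 (differentiableAt_const (Pi.single j (1 : ℝ)))
  refine (congrArg (fun L => L (Pi.single i 1)) h2).trans ?_
  simp

theorem partialDeriv_comm (i j : Fin n) : Commute (partialDeriv i) (partialDeriv j) := by
  refine LinearMap.ext fun f => ?_
  ext x
  refine (partialDeriv_partialDeriv_apply i j f x).trans
    (Eq.trans ?_ (partialDeriv_partialDeriv_apply j i f x).symm)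
  have h : IsSymmSndFDerivAt ℝ (f : (Fin n → ℝ) → ℝ) x :=
    f.contDiff.contDiffAt.isSymmSndFDerivAt (by simpa using WithTop.coe_le_coe.2 (le_top : (2 : ℕ∞) ≤ ⊤))
  exact h _ _

namespace VectorField

/-- The coefficient `X^i` in `X = ∑ X^i ∂_i`. -/
def coeff (X : VectorField n) (i : Fin n) : SmoothFunction n :=
  ⟨fun x => X x i, contDiff_pi.1 X.contDiff i⟩

/-- The vector field `∑ f_i ∂_i`. -/
def ofCoeff (f : Fin n → SmoothFunction n) : VectorField n :=
  ⟨fun x i => (f i : (Fin n → ℝ) → ℝ) x, contDiff_pi.2 fun i => (f i).contDiff⟩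

theorem ext_coeff {X Y : VectorField n} (h : ∀ i, X.coeff i = Y.coeff i) : X = Y := by
  refine Subtype.ext (funext fun x => funext fun i => ?_)
  exact congrArg (fun f : SmoothFunction n => (f : (Fin n → ℝ) → ℝ) x) (h i)

theorem coeff_ofCoeff (f : Fin n → SmoothFunction n) (i : Fin n) : (ofCoeff f).coeff i = f i := rfl

theorem coeff_add (X Y : VectorField n) (i : Fin n) :
    (X + Y).coeff i = X.coeff i + Y.coeff i := rfl

theorem coeff_sub (X Y : VectorField n) (i : Fin n) :
    (X - Y).coeff i = X.coeff i - Y.coeff i := rfl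

theorem coeff_smul (c : ℝ) (X : VectorField n) (i : Fin n) :
    (c • X).coeff i = c • X.coeff i := rfl

theorem coeff_zero (i : Fin n) : (0 : VectorField n).coeff i = 0 := rfl

/-- The pre-Lie product `(∑ f_i ∂_i) ▷ (∑ g_j ∂_j) = ∑ f_i (∂_i g_j) ∂_j` given by the canonical
flat torsion-free connection. -/
instance : Mul (VectorField n) :=
  ⟨fun X Y => ofCoeff fun j => ∑ i, X.coeff i * partialDeriv i (Y.coeff j)⟩

theorem coeff_mul (X Y : VectorField n) (j : Fin n) :
    (X * Y).coeff j = ∑ i, X.coeff i * partialDeriv i (Y.coeff j) := rfl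

instance : NonUnitalNonAssocRing (VectorField n) :=
  { (inferInstance : AddCommGroup (VectorField n)),
    (inferInstance : Mul (VectorField n)) with
    left_distrib := fun X Y Z => ext_coeff fun j => by
      simp only [coeff_mul, coeff_add, map_add, mul_add, Finset.sum_add_distrib]
    right_distrib := fun X Y Z => ext_coeff fun j => by
      simp only [coeff_mul, coeff_add, add_mul, Finset.sum_add_distrib]
    zero_mul := fun X => ext_coeff fun j => by simp [coeff_mul, coeff_zero]
    mul_zero := fun X => ext_coeff fun j => by simp [coeff_mul, coeff_zero] }

theorem coeff_associator (X Y Z : VectorField n) (k : Fin n) :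
    (associator X Y Z).coeff k
      = -∑ i, ∑ j, X.coeff i * (Y.coeff j * partialDeriv i (partialDeriv j (Z.coeff k))) := by
  have h1 : ((X * Y) * Z).coeff k
      = ∑ i, ∑ j, X.coeff i * (partialDeriv i (Y.coeff j) * partialDeriv j (Z.coeff k)) := by
    simp only [coeff_mul, Finset.sum_mul]
    rw [Finset.sum_comm]
    simp only [mul_assoc]
  have h2 : (X * (Y * Z)).coeff k
      = ∑ i, ∑ j, (X.coeff i * (Y.coeff j * partialDeriv i (partialDeriv j (Z.coeff k)))
        + X.coeff i * (partialDeriv i (Y.coeff j) * partialDeriv j (Z.coeff k))) := by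
    simp only [coeff_mul, map_sum, partialDeriv_mul, Finset.mul_sum, mul_add]
  rw [associator_apply, coeff_sub, h1, h2]
  simp only [Finset.sum_add_distrib]
  abel

instance : LeftPreLieRing (VectorField n) where
  assoc_symm' X Y Z := ext_coeff fun k => by
    rw [coeff_associator, coeff_associator, Finset.sum_comm]
    congr 1
    refine Finset.sum_congr rfl fun j _ => Finset.sum_congr rfl fun i _ => ?_
    have h : partialDeriv i (partialDeriv j (Z.coeff k))
        = partialDeriv j (partialDeriv i (Z.coeff k)) :=
      congrArg (fun L : Module.End ℝ (SmoothFunction n) => L (Z.coeff k)) (partialDeriv_comm i j)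
    rw [h, mul_left_comm]

instance : IsScalarTower ℝ (VectorField n) (VectorField n) where
  smul_assoc c X Y := ext_coeff fun j => by
    simp only [smul_eq_mul, coeff_mul, coeff_smul, smul_mul_assoc, Finset.smul_sum]

instance : SMulCommClass ℝ (VectorField n) (VectorField n) where
  smul_comm c X Y := ext_coeff fun j => by
    simp only [smul_eq_mul, coeff_mul, coeff_smul, map_smul, mul_smul_comm, Finset.smul_sum]

instance : LeftPreLieAlgebra ℝ (VectorField n) where

end VectorField

/-- The constant vector field `∂_i`, evaluated at any point: the `i`-th standard basis vector. -/
def basisVector (i : Fin n) : Fin n → ℝ := Pi.single i 1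

/-- The differential operator `∂_{I(v)} = ∏_{w → v} ∂_{F(w)}`, a product of commuting operators
indexed by the incoming vertices `w` of `v`. -/
def incomingDeriv (t : RootedTree) (F : t.Vertex → Fin n) (v : t.Vertex) :
    Module.End ℝ (SmoothFunction n) :=
  (t.incoming v).noncommProd (fun w => partialDeriv (F w)) fun w _ w' _ _ =>
    partialDeriv_comm (F w) (F w')

/-- The characterization of the Cayley map among the morphisms of (left) pre-Lie algebras from the
free pre-Lie algebra on the space of vector fields to the pre-Lie algebra of vector fields: it
sends each generator `•_X` to `X`. -/
def IsCayleyMap (Y : FreePreLie ℝ (VectorField n) →ₙₐ[ℝ] VectorField n) : Prop :=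
  ∀ X : VectorField n, Y (FreePreLie.gen ℝ X) = X

end CayleyMap

end

/-! Existence: take the formula itself as the definition of the image of a tree
(`elementaryDifferential`). It is invariant under isomorphism, and it is linear in each decoration
because the decoration of `v` enters only the factor of `v`. Hence it descends to the free pre-Lie
algebra. Multiplicativity is the Leibniz rule. In the product of the images of `s` and `t`, the
index of the derivative is the label of the root of `s`. Differentiating the product over the
vertices of `t` gives a sum over `v`, in which `∂_{I(v)}` acquires one more derivative. This is the
effect of giving `v` the root of `s` as a new child (`factor_graft_inr`,
`elementaryDifferential_mul`).

Uniqueness: a morphism is determined on the one-vertex trees, since these generate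
(`map_ofTree_eq`). Cut a branch `s` at a child of the root of `t`, leaving `u`. Then `s → u` is `t`
plus the graftings of `s` at the other vertices of `u`. Those trees have as many vertices as `t` but
one root child fewer, while `s` and `u` have fewer vertices, so a double induction applies. The
formula then holds for every Cayley map, because every such map equals the one constructed. -/

noncomputable section

namespace CayleyMap

/-! ### Cutting a rooted tree at a child of the root -/

open Classical in
/-- The restriction of an optional value to a subtype. -/
def restrictOption {V : Type} (p : V → Prop) (o : Option V) : Option {v // p v} :=
  o.bind fun u => if h : p u then some ⟨u, h⟩ else none

theorem restrictOption_eq_some {V : Type} {p : V → Prop} {o : Option V} {u : {v // p v}} :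
    restrictOption p o = some u ↔ o = some u.1 := by
  obtain ⟨u, hu⟩ := u
  rcases o with _ | a
  · simp [restrictOption]
  · by_cases h : p a
    · simp [restrictOption, h]
    · simp only [restrictOption, Option.bind_some, h, dite_false, Option.some.injEq]
      exact ⟨fun h' => by simp at h', fun h' => absurd (h' ▸ hu) h⟩

theorem restrictOption_eq_none {V : Type} {p : V → Prop} {o : Option V} :
    restrictOption p o = none ↔ ∀ u, o = some u → ¬ p u := by
  rcases o with _ | a
  · simp [restrictOption]
  · by_cases h : p a <;> simp [restrictOption, h]

/-! ### Children of a vertex in a grafted tree. -/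

theorem graftTarget_inl_of_none {A B : Type} {f : A → Option A} (g : B → Option B) (v : B) {a : A}
    (h : f a = none) : graftTarget f g v (Sum.inl a) = some (Sum.inr v) := by
  simp [graftTarget, h]

theorem graftTarget_inl_of_some {A B : Type} {f : A → Option A} (g : B → Option B) (v : B) {a b : A}
    (h : f a = some b) : graftTarget f g v (Sum.inl a) = some (Sum.inl b) := by
  simp [graftTarget, h]

/-- The only new edge of a grafting points into `B`, so no vertex of `A` gains a child. -/
theorem filter_graftTarget_inl {A B : Type} [Fintype A] [DecidableEq A] [Fintype B] [DecidableEq B]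
    (f : A → Option A) (g : B → Option B) (v : B) (a : A) :
    (Finset.univ.filter fun w => graftTarget f g v w = some (Sum.inl a))
      = (Finset.univ.filter fun w => f w = some a).disjSum ∅ := by
  ext (x | x)
  · rcases h : f x with _ | y
    · simp [graftTarget_inl_of_none g v h, h]
    · simp [graftTarget_inl_of_some g v h, h]
  · rw [Finset.mem_filter]
    simp [graftTarget]

/-- By `hr`, the new edge leaves `r` and no other vertex of `A`; hence `v` gains exactly the child
`r`, and the other vertices of `B` gain none. -/
theorem filter_graftTarget_inr {A B : Type} [Fintype A] [DecidableEq A] [Fintype B] [DecidableEq B]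
    (f : A → Option A) (g : B → Option B) (r : A) (hr : ∀ a, f a = none ↔ a = r) (v u : B) :
    (Finset.univ.filter fun w => graftTarget f g v w = some (Sum.inr u))
      = (if u = v then {r} else ∅ : Finset A).disjSum
        (Finset.univ.filter fun w => g w = some u) := by
  ext (x | x)
  · rcases h : f x with _ | y
    · have hx := (hr x).1 h
      by_cases huv : u = v
      · simp [graftTarget_inl_of_none g v h, ← hx, huv]
      · simp [graftTarget_inl_of_none g v h, huv, Ne.symm huv]
    · have hx : x ≠ r := fun h' => by simp [(hr x).2 h'] at h
      simp only [graftTarget_inl_of_some g v h, Finset.mem_filter, Finset.mem_univ,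
        Finset.inl_mem_disjSum, true_and]
      split_ifs <;> simp [hx]
  · rw [Finset.mem_filter]
    simp [graftTarget]

namespace RootedTree

variable (t : RootedTree)

/-- `t.Below w v`: the vertex `v` lies in the branch of `t` with root `w`. -/
def Below (w v : t.Vertex) : Prop := Relation.ReflTransGen (fun a b => t.target a = some b) v w

variable {t}

theorem target_root : t.target t.root = none := (t.target_eq_none_iff _).2 rfl

/-- No edge leaves the root, so only the empty path starts there. -/
theorem not_below_root {w : t.Vertex} (hw : w ≠ t.root) : ¬ t.Below w t.root := fun h => by
  rcases h.cases_head with h | ⟨b, hb, -⟩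
  · exact hw h.symm
  · simp [target_root] at hb

/-- Read contrapositively, this says that the complement of a branch is closed under following
edges, so it can carry a tree. -/
theorem Below.of_target {w v u : t.Vertex} (h : t.target v = some u) (hu : t.Below w u) :
    t.Below w v := Relation.ReflTransGen.head h hu

theorem ne_root_of_target {w u : t.Vertex} (h : t.target w = some u) : w ≠ t.root := by
  rintro rfl
  simp [target_root] at h

open Classical in
/-- The branch of `t` with root a child `w` of the root of `t`. -/
def branch (w : t.Vertex) (hw : t.target w = some t.root) : RootedTree where
  Vertex := {v // t.Below w v}
  root := ⟨w, Relation.ReflTransGen.refl⟩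
  target v := restrictOption (t.Below w) (t.target v)
  target_eq_none_iff := by
    rintro ⟨v, hv⟩
    refine restrictOption_eq_none.trans (Iff.trans ?_ Subtype.mk_eq_mk.symm)
    constructor
    · intro h
      by_contra hne
      -- A nonempty path from `v` to `w` has its first step inside the branch, so the restricted
      -- target of `v` would not be `none`.
      rcases hv.cases_head with h' | ⟨b, hb, hbw⟩
      · exact hne h'
      · exact h b hb hbw
    · rintro rfl u hu
      obtain rfl : t.root = u := Option.some_injective _ (hw.symm.trans hu)
      exact not_below_root (ne_root_of_target hw)
  reaches_root := by
    rintro ⟨v, hv⟩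
    induction hv using Relation.ReflTransGen.head_induction_on with
    | refl => exact Relation.ReflTransGen.refl
    | head h h' ih => exact Relation.ReflTransGen.head (restrictOption_eq_some.2 h) ih

open Classical in
/-- What remains of `t` when the branch with root `w` is cut off. -/
def pruned (w : t.Vertex) (hw : t.target w = some t.root) : RootedTree where
  Vertex := {v // ¬ t.Below w v}
  root := ⟨t.root, not_below_root (ne_root_of_target hw)⟩
  target v := restrictOption (fun v => ¬ t.Below w v) (t.target v)
  target_eq_none_iff := by
    rintro ⟨v, hv⟩
    refine restrictOption_eq_none.trans
      (Iff.trans ?_ ((t.target_eq_none_iff v).trans Subtype.mk_eq_mk.symm))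
    constructor
    · intro h
      rcases h' : t.target v with _ | u
      · rfl
      -- Restriction loses no edge here: a parent inside the branch would put `v` in the branch.
      · exact absurd (fun hu => hv (Below.of_target h' hu)) (h u h')
    · intro h u hu
      simp [h] at hu
  reaches_root := by
    rintro ⟨v, hv⟩
    have h := t.reaches_root v
    induction h using Relation.ReflTransGen.head_induction_on with
    | refl => exact Relation.ReflTransGen.refl
    | head h h' ih =>
      exact Relation.ReflTransGen.head (restrictOption_eq_some.2 h)
        (ih fun hu => hv (Below.of_target h hu))

theorem incoming_graft_inl (s t : RootedTree) (v : t.Vertex) (a : s.Vertex) :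
    ((s.graft t v).incoming (Sum.inl a) : Finset (s.Vertex ⊕ t.Vertex))
      = (s.incoming a).disjSum ∅ :=
  filter_graftTarget_inl s.target t.target v a

theorem incoming_graft_inr (s t : RootedTree) (v u : t.Vertex) :
    ((s.graft t v).incoming (Sum.inr u) : Finset (s.Vertex ⊕ t.Vertex))
      = (if u = v then {s.root} else ∅ : Finset s.Vertex).disjSum (t.incoming u) :=
  filter_graftTarget_inr s.target t.target s.root s.target_eq_none_iff v u

end RootedTree

/-! ### Decomposition and size of decorated trees. -/

namespace DecTree

variable {D : Type*}

open CayleyMap.RootedTree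

/-- The branch of a decorated tree with root a child `w` of the root. -/
def branch (t : DecTree D) (w : t.Vertex) (hw : t.target w = some t.root) : DecTree D :=
  { t.toRootedTree.branch w hw with dec := fun v => t.dec v.1 }

/-- What remains of a decorated tree when the branch with root `w` is cut off. -/
def pruned (t : DecTree D) (w : t.Vertex) (hw : t.target w = some t.root) : DecTree D :=
  { t.toRootedTree.pruned w hw with dec := fun v => t.dec v.1 }

open Classical in
-- Cutting removes one edge only, from `w` to the root, and grafting at the root puts it back.
theorem graft_branch_pruned_iso (t : DecTree D) (w : t.Vertex) (hw : t.target w = some t.root) :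
    ((t.branch w hw).graft (t.pruned w hw) (t.pruned w hw).root).Iso t := by
  refine ⟨Equiv.sumCompl (t.Below w), ?_, ?_⟩
  · rintro (⟨v, hv⟩ | ⟨v, hv⟩)
    · rcases h : restrictOption (t.Below w) (t.target v) with _ | b
      -- The only vertex without a target inside the branch is its root `w`, which the grafting
      -- sends to the root of `t`, as in `t` itself.
      · have hvw : v = w :=
          Subtype.ext_iff.1 (((t.branch w hw).target_eq_none_iff ⟨v, hv⟩).1 h)
        refine Eq.trans ?_ (congrArg _
          (graftTarget_inl_of_none (f := (t.branch w hw).target) (t.pruned w hw).target _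
            (a := ⟨v, hv⟩) h)).symm
        exact (congrArg t.target hvw).trans hw
      · refine Eq.trans ?_ (congrArg _
          (graftTarget_inl_of_some (f := (t.branch w hw).target) (t.pruned w hw).target _
            (a := ⟨v, hv⟩) h)).symm
        exact restrictOption_eq_some.1 h
    · change t.target v = ((restrictOption (fun v => ¬ t.Below w v) (t.target v)).map Sum.inr).map
        (Equiv.sumCompl (t.Below w))
      rcases h : restrictOption (fun v => ¬ t.Below w v) (t.target v) with _ | b
      · have hvr : v = t.root :=
          Subtype.ext_iff.1 (((t.pruned w hw).target_eq_none_iff ⟨v, hv⟩).1 h)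
        rw [hvr, target_root]
        rfl
      · exact restrictOption_eq_some.1 h
  · rintro (v | v) <;> rfl

/-- The root is the unique vertex without a target, so preserving edges is enough. -/
theorem Iso.root_eq {s t : DecTree D} {e : s.Vertex ≃ t.Vertex}
    (he : ∀ v, t.target (e v) = (s.target v).map e) : e s.root = t.root := by
  rw [← t.target_eq_none_iff, he, target_root, Option.map_none]

theorem incoming_map {s t : DecTree D} {e : s.Vertex ≃ t.Vertex}
    (he : ∀ v, t.target (e v) = (s.target v).map e) (v : s.Vertex) :
    t.incoming (e v) = (s.incoming v).map e.toEmbedding := by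
  ext x
  obtain ⟨x, rfl⟩ := e.surjective x
  rw [Finset.mem_map_equiv, Equiv.symm_apply_apply]
  simp [incoming, he]

theorem Iso.card_eq {s t : DecTree D} (h : s.Iso t) :
    Fintype.card s.Vertex = Fintype.card t.Vertex := Fintype.card_congr h.choose

theorem Iso.card_incoming_root {s t : DecTree D} (h : s.Iso t) :
    (s.incoming s.root).card = (t.incoming t.root).card := by
  obtain ⟨e, he, -⟩ := h
  rw [← Iso.root_eq he, incoming_map he, Finset.card_map]

theorem card_graft (s t : DecTree D) (v : t.Vertex) :
    Fintype.card (s.graft t v).Vertex = Fintype.card s.Vertex + Fintype.card t.Vertex :=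
  Fintype.card_sum

/-- This controls the inner induction of `map_ofTree_eq`: only a grafting at the root raises the
number of root children. -/
theorem card_incoming_root_graft (s t : DecTree D) (v : t.Vertex) :
    ((s.graft t v).incoming (s.graft t v).root).card
      = (if t.root = v then 1 else 0) + (t.incoming t.root).card := by
  refine (congrArg Finset.card (incoming_graft_inr s.toRootedTree t.toRootedTree v t.root)).trans ?_
  refine (Finset.card_disjSum _ _).trans ?_
  split_ifs <;> simp

/-- The last edge of a nonempty path to the root starts at a child of the root. -/
theorem eq_root_of_incoming_root_eq_empty (t : DecTree D) (h : t.incoming t.root = ∅)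
    (v : t.Vertex) : v = t.root := by
  rcases (t.reaches_root v).cases_tail with h' | ⟨b, -, hb⟩
  · exact h'.symm
  · have : b ∈ t.incoming t.root := by simpa [incoming] using hb
    simp [h] at this

theorem iso_single (t : DecTree D) (h : t.incoming t.root = ∅) : (single (t.dec t.root)).Iso t := by
  have hr := t.eq_root_of_incoming_root_eq_empty h
  refine ⟨⟨fun _ => t.root, fun _ => (), fun _ => rfl, fun v => (hr v).symm⟩, fun _ => ?_,
    fun _ => rfl⟩
  exact target_root

theorem card_pos (t : DecTree D) : 0 < Fintype.card t.Vertex :=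
  Fintype.card_pos_iff.2 ⟨t.root⟩

end DecTree

/-! ### Generation by one-vertex trees and uniqueness of morphisms. -/

namespace FreePreLie

variable {R : Type*} [CommRing R] {M : Type*} [AddCommGroup M] [Module R M]
  {A : Type*} [NonUnitalNonAssocRing A] [Module R A]

/-- Strong induction on the number `N` of vertices and, for fixed `N`, on the number `k` of root
children. Only linearity and multiplicativity of the maps are used, so `A` need not be pre-Lie. -/
theorem map_ofTree_eq {f g : FreePreLie R M →ₙₐ[R] A} (h : ∀ x, f (gen R x) = g (gen R x))
    (N k : ℕ) (t : DecTree M) (hN : Fintype.card t.Vertex = N)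
    (hk : (t.incoming t.root).card = k) : f (ofTree R t) = g (ofTree R t) := by
  induction N using Nat.strong_induction_on generalizing k t with
  | _ N ihN =>
  induction k using Nat.strong_induction_on generalizing t with
  | _ k ihk =>
  rcases (t.incoming t.root).eq_empty_or_nonempty with h0 | ⟨w, hw⟩
  · rw [← ofTree_iso (t.iso_single h0)]
    exact h _
  · replace hw : t.target w = some t.root := by simpa [RootedTree.incoming] using hw
    have hiso := t.graft_branch_pruned_iso w hw
    have hcard := hiso.card_eq
    have hinc := hiso.card_incoming_root
    set s := t.branch w hw
    set u := t.pruned w hw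
    rw [DecTree.card_graft] at hcard
    rw [DecTree.card_incoming_root_graft, if_pos rfl] at hinc
    have hs := s.card_pos
    have hu := u.card_pos
    have hfs := ihN _ (by omega) _ s rfl rfl
    have hfu := ihN _ (by omega) _ u rfl rfl
    -- The term of `s → u` at the root of `u` is `t`; solve for it.
    have hmul : ofTree R t = ofTree R s * ofTree R u
        - ∑ v ∈ Finset.univ.erase u.root, ofTree R (s.graft u v) := by
      rw [ofTree_mul_ofTree, ← Finset.add_sum_erase _ _ (Finset.mem_univ u.root),
        add_sub_cancel_right, ofTree_iso hiso]
    rw [hmul, map_sub, map_sub, map_mul, map_mul, hfs, hfu, map_sum, map_sum]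
    congr 1
    refine Finset.sum_congr rfl fun v hv => ?_
    -- Grafting away from the root keeps the root children of `u`, one fewer than those of `t`, and
    -- the vertex count is still `N`.
    refine ihk _ ?_ (s.graft u v) (by rw [DecTree.card_graft]; omega) rfl
    rw [DecTree.card_incoming_root_graft, if_neg (Finset.ne_of_mem_erase hv).symm]
    omega

/-- Morphisms from the free pre-Lie algebra are determined by their values on the generators. -/
theorem algHom_ext {f g : FreePreLie R M →ₙₐ[R] A} (h : ∀ x, f (gen R x) = g (gen R x)) :
    f = g := by
  refine NonUnitalAlgHom.ext fun a => ?_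
  induction a using induction with
  | htree t => exact map_ofTree_eq h _ _ t rfl rfl
  | hadd a b ha hb => rw [map_add, map_add, ha, hb]
  | hsmul c a ha => rw [map_smul, map_smul, ha]

end FreePreLie

variable {n : ℕ}

/-! ### Elementary differentials -/

/-- The Leibniz rule for `1 * 1` gives `∂1 = ∂1 + ∂1`. -/
theorem partialDeriv_one (i : Fin n) : partialDeriv i (1 : SmoothFunction n) = 0 := by
  have h := partialDeriv_mul i (1 : SmoothFunction n) 1
  rw [one_mul, one_mul, mul_one] at h
  exact left_eq_add.1 h

/-- The conditional inside the full product has the same shape as `factor_graft_inr`, so the two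
match term by term. -/
theorem partialDeriv_prod {ι : Type*} [DecidableEq ι] (i : Fin n) (s : Finset ι)
    (f : ι → SmoothFunction n) :
    partialDeriv i (∏ v ∈ s, f v)
      = ∑ v ∈ s, ∏ u ∈ s, if u = v then partialDeriv i (f u) else f u := by
  induction s using Finset.induction_on with
  | empty => simp [partialDeriv_one]
  | insert a s ha ih =>
    rw [Finset.prod_insert ha, partialDeriv_mul, ih, Finset.sum_insert ha, Finset.prod_insert ha,
      if_pos rfl, add_comm, Finset.mul_sum]
    congr 1
    · congr 1
      exact Finset.prod_congr rfl fun u hu => (if_neg (ne_of_mem_of_not_mem hu ha)).symm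
    · refine Finset.sum_congr rfl fun v hv => ?_
      rw [Finset.prod_insert ha, if_neg (ne_of_mem_of_not_mem hv ha).symm]

/-- The product of the partial derivatives `∂_i` over a multiset of indices. -/
def multiDeriv (m : Multiset (Fin n)) : Module.End ℝ (SmoothFunction n) :=
  (m.map partialDeriv).noncommProd <| by
    intro a ha b hb _
    obtain ⟨i, -, rfl⟩ := Multiset.mem_map.1 ha
    obtain ⟨j, -, rfl⟩ := Multiset.mem_map.1 hb
    exact partialDeriv_comm i j

theorem multiDeriv_cons (i : Fin n) (m : Multiset (Fin n)) :
    multiDeriv (i ::ₘ m) = partialDeriv i * multiDeriv m := by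
  simp [multiDeriv]

/-- The operator depends only on the multiset of labels of the children, which allows comparison
between trees with different vertex types. -/
theorem incomingDeriv_eq_multiDeriv (t : RootedTree) (F : t.Vertex → Fin n) (v : t.Vertex) :
    incomingDeriv t F v = multiDeriv ((t.incoming v).val.map F) := by
  simp [incomingDeriv, multiDeriv, Finset.noncommProd]

namespace DecTree

/-- The factor `∂_{I(v)} X_v^{F(v)}` of the elementary differential of `t`. -/
def factor (t : DecTree (VectorField n)) (F : t.Vertex → Fin n) (v : t.Vertex) :
    SmoothFunction n :=
  incomingDeriv t.toRootedTree F v ((t.dec v).coeff (F v))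

theorem factor_iso {s t : DecTree (VectorField n)} {e : s.Vertex ≃ t.Vertex}
    (he : ∀ v, t.target (e v) = (s.target v).map e) (hd : ∀ v, t.dec (e v) = s.dec v)
    (F : t.Vertex → Fin n) (v : s.Vertex) : t.factor F (e v) = s.factor (F ∘ e) v := by
  rw [factor, factor, incomingDeriv_eq_multiDeriv, incomingDeriv_eq_multiDeriv,
    incoming_map he, hd, Finset.map_val, Multiset.map_map]
  rfl

/-- The source of multilinearity: a decoration affects one factor, through a linear operator. -/
theorem factor_redecorate (t : DecTree (VectorField n)) (v : t.Vertex) (X : VectorField n)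
    (F : t.Vertex → Fin n) :
    (t.redecorate v X).factor F = Function.update (t.factor F) v
      (incomingDeriv t.toRootedTree F v (X.coeff (F v))) := by
  refine funext fun u : t.Vertex => ?_
  change incomingDeriv t.toRootedTree F u ((Function.update t.dec v X u).coeff (F u)) = _
  rcases eq_or_ne u v with h | h
  · rw [h, Function.update_self, Function.update_self]
  · rw [Function.update_of_ne h, Function.update_of_ne h, factor]

theorem factor_graft_inl (s t : DecTree (VectorField n)) (v : t.Vertex)
    (F : s.Vertex ⊕ t.Vertex → Fin n) (a : s.Vertex) :
    (s.graft t v).factor F (Sum.inl a) = s.factor (F ∘ Sum.inl) a := by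
  change incomingDeriv (s.toRootedTree.graft t.toRootedTree v) F (Sum.inl a)
    ((s.dec a).coeff (F (Sum.inl a))) = _
  have h : Multiset.map F
      ((s.toRootedTree.graft t.toRootedTree v).incoming (Sum.inl a)).val
        = (s.incoming a).val.map (F ∘ Sum.inl) := by
    refine (congrArg (fun A : Finset (s.Vertex ⊕ t.Vertex) => A.val.map F)
      (RootedTree.incoming_graft_inl s.toRootedTree t.toRootedTree v a)).trans ?_
    simp
  rw [factor, incomingDeriv_eq_multiDeriv]
  exact LinearMap.congr_fun ((incomingDeriv_eq_multiDeriv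
    (s.toRootedTree.graft t.toRootedTree v) F (Sum.inl a)).trans (congrArg multiDeriv h)) _

/-- The new child of `v` is the root of `s`, so its label contributes one further derivative at `v`
and nothing elsewhere. -/
theorem factor_graft_inr (s t : DecTree (VectorField n)) (v : t.Vertex)
    (F : s.Vertex ⊕ t.Vertex → Fin n) (u : t.Vertex) :
    (s.graft t v).factor F (Sum.inr u)
      = if u = v then partialDeriv (F (Sum.inl s.root)) (t.factor (F ∘ Sum.inr) u)
        else t.factor (F ∘ Sum.inr) u := by
  change incomingDeriv (s.toRootedTree.graft t.toRootedTree v) F (Sum.inr u)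
    ((t.dec u).coeff (F (Sum.inr u))) = _
  have h : Multiset.map F
      ((s.toRootedTree.graft t.toRootedTree v).incoming (Sum.inr u)).val
        = if u = v then F (Sum.inl s.root) ::ₘ (t.incoming u).val.map (F ∘ Sum.inr)
          else (t.incoming u).val.map (F ∘ Sum.inr) := by
    refine (congrArg (fun A : Finset (s.Vertex ⊕ t.Vertex) => A.val.map F)
      (RootedTree.incoming_graft_inr s.toRootedTree t.toRootedTree v u)).trans ?_
    split_ifs <;> simp [Multiset.disjSum]
  rw [factor, incomingDeriv_eq_multiDeriv]
  refine (LinearMap.congr_fun ((incomingDeriv_eq_multiDeriv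
    (s.toRootedTree.graft t.toRootedTree v) F (Sum.inr u)).trans (congrArg multiDeriv h)) _).trans ?_
  split_ifs
  · rw [multiDeriv_cons]
    rfl
  · rfl

/-- The vector field `∑_F ∏_v ∂_{I(v)} X_v^{F(v)} ∂_{F(r)}`. -/
def elementaryDifferential (t : DecTree (VectorField n)) : VectorField n :=
  VectorField.ofCoeff fun k =>
    ∑ F : t.Vertex → Fin n, if F t.root = k then ∏ v, t.factor F v else 0

theorem coeff_elementaryDifferential (t : DecTree (VectorField n)) (k : Fin n) :
    t.elementaryDifferential.coeff k
      = ∑ F : t.Vertex → Fin n, if F t.root = k then ∏ v, t.factor F v else 0 := rfl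

theorem elementaryDifferential_single (X : VectorField n) :
    (single X).elementaryDifferential = X := by
  refine VectorField.ext_coeff fun k => ?_
  have h : ∀ F : Unit → Fin n, (single X).factor F () = X.coeff (F ()) := fun F => by
    have : (single X).incoming () = ∅ := by
      refine Finset.filter_eq_empty_iff.2 fun x _ h => ?_
      cases h
    refine LinearMap.congr_fun
      ((incomingDeriv_eq_multiDeriv RootedTree.single F ()).trans (congrArg multiDeriv (a₂ := 0) ?_)) _
    exact congrArg (fun A : Finset Unit => A.val.map F) this
  change ∑ F : Unit → Fin n, (if F () = k then ∏ v : Unit, (single X).factor F v else 0) = _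
  rw [Fintype.sum_equiv (Equiv.funUnique Unit (Fin n)) _
    (fun i => if i = k then X.coeff i else 0) fun F =>
      congrArg (fun a => if F () = k then a else 0)
        ((Fintype.prod_unique (ι := Unit) _).trans (h F))]
  simp

theorem elementaryDifferential_iso {s t : DecTree (VectorField n)} (h : s.Iso t) :
    s.elementaryDifferential = t.elementaryDifferential := by
  obtain ⟨e, he, hd⟩ := h
  refine VectorField.ext_coeff fun k => ?_
  refine (Fintype.sum_equiv (e.arrowCongr (Equiv.refl (Fin n))).symm _ _ fun F => ?_).symm
  rw [← Iso.root_eq he, ← Equiv.prod_comp e]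
  simp only [factor_iso he hd]
  rfl

theorem coeff_elementaryDifferential_redecorate (t : DecTree (VectorField n)) (v : t.Vertex)
    (X : VectorField n) (k : Fin n) :
    (t.redecorate v X).elementaryDifferential.coeff k
      = ∑ F : t.Vertex → Fin n, if F t.root = k then
          incomingDeriv t.toRootedTree F v (X.coeff (F v)) *
            ∏ u ∈ Finset.univ \ {v}, t.factor F u else 0 := by
  refine Finset.sum_congr rfl fun F _ => ?_
  refine congrArg (fun a => if F t.root = k then a else 0) ?_
  refine (congrArg (fun f : t.Vertex → SmoothFunction n => ∏ u, f u)
    (factor_redecorate t v X F)).trans ?_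
  exact Finset.prod_update_of_mem (Finset.mem_univ v) _ _

theorem elementaryDifferential_redecorate_add (t : DecTree (VectorField n)) (v : t.Vertex)
    (X Y : VectorField n) :
    (t.redecorate v (X + Y)).elementaryDifferential
      = (t.redecorate v X).elementaryDifferential + (t.redecorate v Y).elementaryDifferential := by
  refine VectorField.ext_coeff fun k => ?_
  rw [VectorField.coeff_add]
  simp only [coeff_elementaryDifferential_redecorate, ← Finset.sum_add_distrib]
  refine Finset.sum_congr rfl fun F _ => ?_
  split_ifs
  · rw [VectorField.coeff_add, map_add, add_mul]
  · rw [add_zero]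

theorem elementaryDifferential_redecorate_smul (t : DecTree (VectorField n)) (v : t.Vertex)
    (c : ℝ) (X : VectorField n) :
    (t.redecorate v (c • X)).elementaryDifferential
      = c • (t.redecorate v X).elementaryDifferential := by
  refine VectorField.ext_coeff fun k => ?_
  rw [VectorField.coeff_smul]
  simp only [coeff_elementaryDifferential_redecorate, Finset.smul_sum]
  refine Finset.sum_congr rfl fun F _ => ?_
  split_ifs
  · rw [VectorField.coeff_smul, map_smul, smul_mul_assoc]
  · rw [smul_zero]

/-- A labelling of the grafted tree is a pair of labellings of `s` and `t`, and its root is that of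
`t`. -/
theorem coeff_elementaryDifferential_graft (s t : DecTree (VectorField n)) (v : t.Vertex)
    (k : Fin n) :
    (s.graft t v).elementaryDifferential.coeff k
      = ∑ F : s.Vertex → Fin n, ∑ G : t.Vertex → Fin n,
          if G t.root = k then (∏ a, s.factor F a) *
            ∏ u, if u = v then partialDeriv (F s.root) (t.factor G u) else t.factor G u
          else 0 := by
  rw [← Fintype.sum_prod_type']
  refine Fintype.sum_equiv (Equiv.sumArrowEquivProdArrow s.Vertex t.Vertex (Fin n)) _ _ fun F => ?_
  refine congrArg (fun a => if F (Sum.inr t.root) = k then a else 0) ?_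
  refine (Fintype.prod_sum_type (α₁ := s.Vertex) (α₂ := t.Vertex) _).trans ?_
  exact congrArg₂ (· * ·) (Finset.prod_congr rfl fun a _ => factor_graft_inl s t v F a)
    (Finset.prod_congr rfl fun u _ => factor_graft_inr s t v F u)

/-- The Leibniz rule over the vertices of `t` produces one term for each grafting vertex. -/
theorem elementaryDifferential_mul (s t : DecTree (VectorField n)) :
    s.elementaryDifferential * t.elementaryDifferential
      = ∑ v : t.Vertex, (s.graft t v).elementaryDifferential := by
  refine VectorField.ext_coeff fun k => ?_
  have hsum : (∑ v : t.Vertex, (s.graft t v).elementaryDifferential).coeff k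
      = ∑ v : t.Vertex, (s.graft t v).elementaryDifferential.coeff k :=
    map_sum (AddMonoidHom.mk' (fun X : VectorField n => X.coeff k)
      fun X Y => VectorField.coeff_add X Y k) _ _
  rw [hsum, VectorField.coeff_mul]
  simp only [coeff_elementaryDifferential_graft]
  rw [Finset.sum_comm]
  simp only [coeff_elementaryDifferential s, Finset.sum_mul, ite_mul, zero_mul]
  rw [Finset.sum_comm]
  refine Finset.sum_congr rfl fun F _ => ?_
  -- For a fixed labelling `F` of `s`, the sum over the index of the derivative collapses to the
  -- label `F s.root`.
  rw [Finset.sum_ite_eq, if_pos (Finset.mem_univ _), Finset.sum_comm, coeff_elementaryDifferential,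
    map_sum, Finset.mul_sum]
  refine Finset.sum_congr rfl fun G _ => ?_
  split_ifs
  · rw [partialDeriv_prod, Finset.mul_sum]
  · rw [map_zero, mul_zero, Finset.sum_const_zero]

theorem elementaryDifferential_apply (t : DecTree (VectorField n)) (x : Fin n → ℝ) :
    t.elementaryDifferential x
      = ∑ F : t.Vertex → Fin n,
          ((∏ v ∈ Finset.univ.erase t.root,
              (incomingDeriv t.toRootedTree F v ((t.dec v).coeff (F v))).1 x) *
            (incomingDeriv t.toRootedTree F t.root ((t.dec t.root).coeff (F t.root))).1 x) •
            basisVector (F t.root) := by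
  funext k
  -- Evaluation at `x` is written as a ring homomorphism so that it commutes with the finite sums
  -- and products.
  have heval : ∀ f : SmoothFunction n, f.1 x
      = ((Pi.evalRingHom (fun _ : Fin n → ℝ => ℝ) x).comp (smoothFunctions n).val.toRingHom) f :=
    fun _ => rfl
  change (∑ F : t.Vertex → Fin n, if F t.root = k then ∏ v, t.factor F v else 0 :
    SmoothFunction n).1 x = _
  rw [heval, map_sum, Finset.sum_apply]
  refine Finset.sum_congr rfl fun F _ => ?_
  rw [Finset.prod_erase_mul _ _ (Finset.mem_univ _), Pi.smul_apply, basisVector, smul_eq_mul]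
  by_cases h : F t.root = k
  · subst h
    rw [if_pos rfl, Pi.single_eq_same, mul_one, map_prod]
    rfl
  · rw [if_neg h, map_zero, Pi.single_eq_of_ne (Ne.symm h), mul_zero]

end DecTree

/-! ### The Cayley map on the free pre-Lie algebra. -/

theorem relations_le_ker_elementaryDifferential :
    relations ℝ (VectorField n) ≤ LinearMap.ker (Finsupp.lift (VectorField n) ℝ
      (DecTree (VectorField n)) DecTree.elementaryDifferential) := by
  refine Submodule.span_le.2 ?_
  rintro _ (⟨s, t, h⟩ | ⟨t, v, X, Y⟩ | ⟨t, v, c, X⟩)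
  · rw [SetLike.mem_coe, LinearMap.mem_ker, map_sub, FreePreLie.lift_single,
      FreePreLie.lift_single, DecTree.elementaryDifferential_iso h, sub_self]
  · rw [SetLike.mem_coe, LinearMap.mem_ker, map_sub, map_add, FreePreLie.lift_single,
      FreePreLie.lift_single, FreePreLie.lift_single,
      DecTree.elementaryDifferential_redecorate_add, sub_self]
  · rw [SetLike.mem_coe, LinearMap.mem_ker, map_sub, map_smul, FreePreLie.lift_single,
      FreePreLie.lift_single, DecTree.elementaryDifferential_redecorate_smul, sub_self]

/-- The linear map sending each tree to its elementary differential. -/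
def cayleyLinearMap : FreePreLie ℝ (VectorField n) →ₗ[ℝ] VectorField n :=
  (relations ℝ (VectorField n)).liftQ _ relations_le_ker_elementaryDifferential

theorem cayleyLinearMap_ofTree (t : DecTree (VectorField n)) :
    cayleyLinearMap (FreePreLie.ofTree ℝ t) = t.elementaryDifferential :=
  FreePreLie.lift_single _ t

/-- Both sides are bilinear, so trees suffice, and there the claim is `elementaryDifferential_mul`.
-/
theorem cayleyLinearMap_mul (a b : FreePreLie ℝ (VectorField n)) :
    cayleyLinearMap (a * b) = cayleyLinearMap a * cayleyLinearMap b := by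
  induction a using FreePreLie.induction with
  | hadd a a' ha ha' => rw [add_mul, map_add, ha, ha', map_add, add_mul]
  | hsmul c a ha => rw [smul_mul_assoc, map_smul, ha, map_smul, smul_mul_assoc]
  | htree s =>
  induction b using FreePreLie.induction with
  | hadd b b' hb hb' => rw [mul_add, map_add, hb, hb', map_add, mul_add]
  | hsmul c b hb => rw [mul_smul_comm, map_smul, hb, map_smul, mul_smul_comm]
  | htree t =>
    rw [FreePreLie.ofTree_mul_ofTree, map_sum, cayleyLinearMap_ofTree, cayleyLinearMap_ofTree,
      DecTree.elementaryDifferential_mul]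
    exact Finset.sum_congr rfl fun v _ => cayleyLinearMap_ofTree _

/-- The Cayley map. -/
def cayleyMap : FreePreLie ℝ (VectorField n) →ₙₐ[ℝ] VectorField n :=
  { cayleyLinearMap with
    map_zero' := map_zero cayleyLinearMap
    map_mul' := cayleyLinearMap_mul }

theorem isCayleyMap_cayleyMap : IsCayleyMap (cayleyMap (n := n)) := fun X =>
  (cayleyLinearMap_ofTree _).trans (DecTree.elementaryDifferential_single X)

theorem IsCayleyMap.eq {Y : FreePreLie ℝ (VectorField n) →ₙₐ[ℝ] VectorField n}
    (h : IsCayleyMap Y) : Y = cayleyMap :=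
  FreePreLie.algHom_ext fun X => (h X).trans (isCayleyMap_cayleyMap X).symm

end CayleyMap

end

theorem mainTheorem10 (n : ℕ) :
    (∃! Y : CayleyMap.FreePreLie ℝ (CayleyMap.VectorField n) →ₙₐ[ℝ] CayleyMap.VectorField n,
      CayleyMap.IsCayleyMap Y) ∧
    ∀ Y : CayleyMap.FreePreLie ℝ (CayleyMap.VectorField n) →ₙₐ[ℝ] CayleyMap.VectorField n,
      CayleyMap.IsCayleyMap Y →
      ∀ (t : CayleyMap.DecTree (CayleyMap.VectorField n)) (x : Fin n → ℝ),
        Y (CayleyMap.FreePreLie.ofTree ℝ t) x =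
          ∑ F : t.Vertex → Fin n,
            ((∏ v ∈ Finset.univ.erase t.root,
                (CayleyMap.incomingDeriv t.toRootedTree F v ((t.dec v).coeff (F v))).1 x) *
              (CayleyMap.incomingDeriv t.toRootedTree F t.root
                ((t.dec t.root).coeff (F t.root))).1 x) •
              CayleyMap.basisVector (F t.root) := by
  refine ⟨⟨CayleyMap.cayleyMap, CayleyMap.isCayleyMap_cayleyMap, fun _ h => h.eq⟩,
    fun Y h t x => ?_⟩
  rw [h.eq, ← CayleyMap.DecTree.elementaryDifferential_apply]
  exact congrArg (fun X : CayleyMap.VectorField n => X x) (CayleyMap.cayleyLinearMap_ofTree t)
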